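/- Let $\mathbb{K}=\mathbb{R}$ or $\mathbb{C}$, let $p\in(1,\infty)\setminus\{2\}$, let $(\mathbb{X}_n)_{n\in\mathbb{N}}$ be non-trivial normed spaces over $\mathbb{K}$, and let $\bigoplus_p\mathbb{X}_n$ be the space of sequences $x=(x_n)$ with $x_n\in\mathbb{X}_n$ and $\|x\|_p=\left(\sum_n\|x_n\|^p\right)^{1/p}<\infty$. For $u,v$ in a normed space $\mathbb{X}$ over $\mathbb{K}$ write $u\perp_B v$ if $\|u+\lambda v\|\ge\|u\|$ for all $\lambda\in\mathbb{K}$. The point $u$ is left-symmetric if $u\perp_B v\Rightarrow v\perp_B u$ for all $v\in\mathbb{X}$, and right-symmetric if $v\perp_B u\Rightarrow u\perp_B v$ for all $v\in\mathbb{X}$. A non-zero $u$ is smooth if there is exactly one $f\in\mathbb{X}^*$ with $\|f\|=1$ and $f(u)=\|u\|$. A semi-inner product on $\mathbb{X}$ is a map $[\cdot,\cdot]:\mathbb{X}\times\mathbb{X}\to\mathbb{K}$ that is linear in the second variable and satisfies $[\lambda u,v]=\overline{\lambda}[u,v]$, $|[u,v]|^2\le[u,u][v,v]$ and $[u,u]=\|u\|^2$.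 The point $u$ is $p$-left (resp. $p$-right) s.i.p. symmetric if for every $v\in\mathbb{X}\setminus\{0\}$ and every semi-inner product $[\cdot,\cdot]$ on $\mathbb{X}$ there is a semi-inner product $[\cdot,\cdot]'$ on $\mathbb{X}$ such that $$[v,u]'=\left|\frac{[u,v]}{\|u\|\|v\|}\right|^{p-2}\overline{[u,v]}\qquad\left(\text{resp. }[v,u]=\left|\frac{[u,v]'}{\|u\|\|v\|}\right|^{p-2}\overline{[u,v]'}\right),$$ where the right-hand side is read as $0$ if the semi-inner product in it vanishes. Let $x=(x_n)\in\bigoplus_p\mathbb{X}_n$. Then: 1. If $x$ is left-symmetric, then either there is $n_0$ such that $x_n=0$ for all $n\ne n_0$ and $x_{n_0}$ is a left-symmetric point of $\mathbb{X}_{n_0}$, or there are $m\ne k$ such that $x_n=0$ for all $n\ne m,k$, $\|x_m\|=\|x_k\|\ne0$, and $x_m$, $x_k$ are smooth $p$-left s.i.p. symmetric points of $\mathbb{X}_m$, $\mathbb{X}_k$ respectively. 2. If $x$ is right-symmetric, then either there is $n_0$ such that $x_n=0$ for all $n\ne n_0$ and $x_{n_0}$ is a right-symmetric point of $\mathbb{X}_{n_0}$,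 or there are $m\ne k$ such that $x_n=0$ for all $n\ne m,k$, $\|x_m\|=\|x_k\|\ne0$, and $x_m$, $x_k$ are $p$-right s.i.p. symmetric points of $\mathbb{X}_m$, $\mathbb{X}_k$ respectively. -/

import Mathlib

open scoped ENNReal

section Definitions

variable (𝕜 : Type*) [RCLike 𝕜] {E : Type*} [NormedAddCommGroup E] [NormedSpace 𝕜 E]

/-- Birkhoff-James orthogonality `x ⊥_B y`. -/
def BirkhoffOrthogonal (x y : E) : Prop :=
  ∀ c : 𝕜, ‖x‖ ≤ ‖x + c • y‖

/-- `x` is a left-symmetric point. -/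
def IsLeftSymmetric (x : E) : Prop :=
  ∀ y : E, BirkhoffOrthogonal 𝕜 x y → BirkhoffOrthogonal 𝕜 y x

/-- `x` is a right-symmetric point. -/
def IsRightSymmetric (x : E) : Prop :=
  ∀ y : E, BirkhoffOrthogonal 𝕜 y x → BirkhoffOrthogonal 𝕜 x y

/-- `f` is a support functional of `x`. -/
def IsSupportFunctional (x : E) (f : E →L[𝕜] 𝕜) : Prop :=
  ‖f‖ = 1 ∧ f x = (‖x‖ : 𝕜)

/-- `x` is a smooth point: it is non-zero and has a unique support functional. -/
def IsSmoothPoint (x : E) : Prop :=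
  x ≠ 0 ∧ ∃! f : E →L[𝕜] 𝕜, IsSupportFunctional 𝕜 x f

variable {𝕜} in
/-- A semi-inner product on the normed space `E`, linear in the second variable and
compatible with the norm. Positivity and definiteness of `s x x` are part of `self_eq`. -/
structure IsSemiInnerProduct (s : E → E → 𝕜) : Prop where
  self_eq : ∀ x, s x x = (‖x‖ : 𝕜) ^ 2
  add_smul_right : ∀ (x y z : E) (c : 𝕜), s x (y + c • z) = s x y + c * s x z
  smul_left : ∀ (c : 𝕜) (x y : E), s (c • x) y = (starRingEnd 𝕜) c * s x y
  cauchy_schwarz : ∀ x y, ‖s x y‖ ^ 2 ≤ ‖s x x‖ * ‖s y y‖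

/-- The expression `|[x, y] / (‖x‖ ‖y‖)| ^ (p - 2) * conj [x, y]`, where `a = [x, y]`.
It is `0` when `a = 0`, also for `p < 2`. -/
noncomputable def sipTwist (p : ℝ) (x y : E) (a : 𝕜) : 𝕜 :=
  (((‖a‖ / (‖x‖ * ‖y‖)) ^ (p - 2) : ℝ) : 𝕜) * (starRingEnd 𝕜) a

/-- `x` is `p`-left s.i.p. commuting with `y`. -/
def IsLeftSipCommuting (p : ℝ) (x y : E) : Prop :=
  ∀ s : E → E → 𝕜, IsSemiInnerProduct s →
    ∃ s' : E → E → 𝕜, IsSemiInnerProduct s' ∧ s' y x = sipTwist 𝕜 p x y (s x y)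

/-- `x` is `p`-right s.i.p. commuting with `y`. -/
def IsRightSipCommuting (p : ℝ) (x y : E) : Prop :=
  ∀ s : E → E → 𝕜, IsSemiInnerProduct s →
    ∃ s' : E → E → 𝕜, IsSemiInnerProduct s' ∧ s y x = sipTwist 𝕜 p x y (s' x y)

/-- `x` is `p`-left s.i.p. symmetric. -/
def IsLeftSipSymmetric (p : ℝ) (x : E) : Prop :=
  ∀ y : E, y ≠ 0 → IsLeftSipCommuting 𝕜 p x y

/-- `x` is `p`-right s.i.p. symmetric. -/
def IsRightSipSymmetric (p : ℝ) (x : E) : Prop :=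
  ∀ y : E, y ≠ 0 → IsRightSipCommuting 𝕜 p x y

end Definitions

/-! By James' characterization and an analysis of the dual of the sum, `x ⊥_B y` holds exactly when
the coordinates `x n` have norming functionals `f n` with `∑ ‖x n‖ ^ (p - 1) * f n (y n) = 0`
(`lp.birkhoffOrthogonal_iff`). Everything follows by testing symmetry on special `y`.

Take `y n = c n • x n` with real weights on a finite set, and put `a n = ‖x n‖ ^ p`. Then `x ⊥_B y`
reads `∑ c n * a n = 0`, and `y ⊥_B x` reads `∑ |c n| ^ (p - 2) * c n * a n = 0`. For `p ≠ 2` an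
implication between these two equations, in either direction, forces all non-zero coordinates to
have equal norm and leaves at most two of them.

If two remain, take `y` equal to `v` at `m` and to `t • x k` at `k`. Eliminating `t` from the two
orthogonality relations leaves `SipRelated` between norming functionals of `x m` and of `v`, which
is s.i.p. symmetry. On the left side this relation also gives smoothness: a second norming
functional would make the norm drop below `‖x m‖` along a line on which it cannot. -/

/-! ### Norming functionals and James' characterization. -/

section Norming

variable (𝕜 : Type*) [RCLike 𝕜] {E : Type*} [NormedAddCommGroup E] [NormedSpace 𝕜 E]

variable {𝕜} in
/-- `f` has norm at most one and attains the norm of `x` at `x`. -/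
def IsNorming (x : E) (f : E →L[𝕜] 𝕜) : Prop :=
  ‖f‖ ≤ 1 ∧ f x = (‖x‖ : 𝕜)

theorem exists_isNorming (x : E) : ∃ f : E →L[𝕜] 𝕜, IsNorming x f :=
  exists_dual_vector'' 𝕜 x

variable {𝕜}

theorem IsNorming.norm_apply_le {x : E} {f : E →L[𝕜] 𝕜} (hf : IsNorming x f) (y : E) :
    ‖f y‖ ≤ ‖y‖ := by
  simpa using f.le_of_opNorm_le hf.1 y

theorem isSupportFunctional_iff_isNorming {x : E} (hx : x ≠ 0) {f : E →L[𝕜] 𝕜} :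
    IsSupportFunctional 𝕜 x f ↔ IsNorming x f := by
  refine ⟨fun h => ⟨h.1.le, h.2⟩, fun h => ⟨le_antisymm h.1 ?_, h.2⟩⟩
  have h1 : ‖f x‖ = ‖x‖ := by rw [h.2]; simp
  have h2 := f.le_opNorm x
  rw [h1] at h2
  have h3 : 0 < ‖x‖ := norm_pos_iff.2 hx
  nlinarith

/-- If `f` is norming at `t • x` then its value at `x` is the conjugate phase of `t`. -/
theorem IsNorming.norm_mul_apply_of_smul {x : E} {t : 𝕜} {f : E →L[𝕜] 𝕜}
    (hf : IsNorming (t • x) f) : (‖t‖ : 𝕜) * f x = (starRingEnd 𝕜) t * (‖x‖ : 𝕜) := by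
  rcases eq_or_ne t 0 with rfl | ht
  · simp
  have h := hf.2
  rw [map_smul, smul_eq_mul, norm_smul] at h
  push_cast at h
  have h2 : (‖t‖ : 𝕜) ≠ 0 := by simpa using ht
  apply mul_left_cancel₀ h2
  calc (‖t‖ : 𝕜) * ((‖t‖ : 𝕜) * f x) = ((starRingEnd 𝕜) t * t) * f x := by
        rw [RCLike.conj_mul]; ring
    _ = (starRingEnd 𝕜) t * (t * f x) := by ring
    _ = _ := by rw [h]; ring

/-- **James' characterization** of Birkhoff orthogonality. -/
theorem birkhoffOrthogonal_iff_exists_isNorming {x y : E} :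
    BirkhoffOrthogonal 𝕜 x y ↔ ∃ f : E →L[𝕜] 𝕜, IsNorming x f ∧ f y = 0 := by
  constructor
  · intro h
    -- Orthogonality says that `x` keeps its norm modulo the span of `y`; a norming functional on
    -- the quotient then pulls back to one that kills `y`.
    let S : Submodule 𝕜 E := Submodule.span 𝕜 {y}
    obtain ⟨g, hg, hgx⟩ := exists_dual_vector'' 𝕜 (S.mkQL x)
    have hle : ∀ z, ‖S.mkQL z‖ ≤ ‖z‖ := fun z => Submodule.Quotient.norm_mk_le S z
    have hnorm : ‖S.mkQL x‖ = ‖x‖ := by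
      refine le_antisymm (hle x) ?_
      refine QuotientAddGroup.le_norm_iff.2 fun m hm => ?_
      have hm' : m - x ∈ S := (Submodule.Quotient.eq S).1 hm
      obtain ⟨c, hc⟩ := Submodule.mem_span_singleton.1 hm'
      have := h c
      rwa [hc, add_sub_cancel] at this
    refine ⟨g.comp S.mkQL, ⟨?_, ?_⟩, ?_⟩
    · refine ContinuousLinearMap.opNorm_le_bound _ zero_le_one fun z => ?_
      calc ‖g (S.mkQL z)‖ ≤ 1 * ‖S.mkQL z‖ := g.le_of_opNorm_le hg _
        _ ≤ 1 * ‖z‖ := by gcongr; exact hle z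
    · rw [ContinuousLinearMap.comp_apply, hgx, hnorm]
    · have : S.mkQL y = 0 :=
        (Submodule.Quotient.mk_eq_zero S).2 (Submodule.mem_span_singleton_self y)
      rw [ContinuousLinearMap.comp_apply, this, map_zero]
  · rintro ⟨f, hf, hfy⟩ c
    calc ‖x‖ = ‖f (x + c • y)‖ := by rw [map_add, map_smul, hfy, hf.2]; simp
      _ ≤ _ := hf.norm_apply_le _

end Norming

/-! ### Semi-inner products as choices of norming functionals. -/

section SemiInnerProduct

variable {𝕜 : Type*} [RCLike 𝕜] {E : Type*} [NormedAddCommGroup E] [NormedSpace 𝕜 E]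

/-- A semi-inner product with non-zero first argument comes from a norming functional. -/
theorem IsSemiInnerProduct.exists_isNorming {s : E → E → 𝕜} (hs : IsSemiInnerProduct s) {x : E}
    (hx : x ≠ 0) : ∃ f : E →L[𝕜] 𝕜, IsNorming x f ∧ ∀ y, s x y = (‖x‖ : 𝕜) * f y := by
  have hx0 : 0 < ‖x‖ := norm_pos_iff.2 hx
  have hx1 : (‖x‖ : 𝕜) ≠ 0 := by simpa using hx
  have hzero : s x 0 = 0 := by simpa using hs.add_smul_right x 0 0 1
  let l : E →ₗ[𝕜] 𝕜 :=
    { toFun := fun y => (‖x‖ : 𝕜)⁻¹ * s x y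
      map_add' := fun y z => by
        have := hs.add_smul_right x y z 1
        simp only [one_smul, one_mul] at this
        rw [this, mul_add]
      map_smul' := fun c z => by
        have := hs.add_smul_right x 0 z c
        simp only [zero_add, hzero] at this
        rw [this]; simp only [RingHom.id_apply, smul_eq_mul]; ring }
  have hl : ∀ y, ‖l y‖ ≤ 1 * ‖y‖ := by
    intro y
    have h1 := hs.cauchy_schwarz x y
    rw [hs.self_eq, hs.self_eq] at h1
    simp only [norm_pow, RCLike.norm_ofReal, abs_norm] at h1
    have h2 : ‖s x y‖ ≤ ‖x‖ * ‖y‖ := by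
      apply le_of_sq_le_sq _ (by positivity)
      nlinarith
    change ‖(‖x‖ : 𝕜)⁻¹ * s x y‖ ≤ _
    rw [norm_mul, norm_inv, RCLike.norm_ofReal, abs_norm, one_mul, inv_mul_le_iff₀ hx0]
    exact h2
  refine ⟨l.mkContinuous 1 hl, ⟨l.mkContinuous_norm_le zero_le_one hl, ?_⟩, fun y => ?_⟩
  · change (‖x‖ : 𝕜)⁻¹ * s x x = _
    rw [hs.self_eq]; field_simp
  · change _ = (‖x‖ : 𝕜) * ((‖x‖ : 𝕜)⁻¹ * s x y)
    field_simp

/-- Every norming functional at a non-zero vector is induced by a semi-inner product. -/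
theorem IsNorming.exists_isSemiInnerProduct {v : E} (hv : v ≠ 0) {h : E →L[𝕜] 𝕜}
    (hh : IsNorming v h) :
    ∃ s : E → E → 𝕜, IsSemiInnerProduct s ∧ ∀ y, s v y = (‖v‖ : 𝕜) * h y := by
  classical
  have hψ : ∀ u : E, ∃ f : E →L[𝕜] 𝕜, IsNorming u f ∧ (u = v → f = h) := by
    intro u
    by_cases hu : u = v
    · exact ⟨h, hu ▸ hh, fun _ => rfl⟩
    · obtain ⟨f, hf⟩ := _root_.exists_isNorming 𝕜 u
      exact ⟨f, hf, fun h => absurd h hu⟩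
  choose ψ hψ hψv using hψ
  -- Conjugate homogeneity allows only one free choice of functional per line. So `ρ` picks a
  -- representative of each scalar orbit, with `v` representing its own, and `c` records the scalar.
  let R := MulAction.orbitRel 𝕜ˣ E
  let q : E → Quotient R := Quotient.mk R
  let ρ : E → E := fun u => if q u = q v then v else (q u).out
  have hqρ : ∀ u, q (ρ u) = q u := by
    intro u
    by_cases hu : q u = q v
    · simp [ρ, hu]
    · simp only [ρ, hu, if_false]; exact Quotient.out_eq _
  have hρ : ∀ u w, q u = q w → ρ u = ρ w := by
    intro u w huw; simp only [ρ, huw]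
  have hc : ∀ u, ∃ c : 𝕜ˣ, u = c • ρ u := by
    intro u
    obtain ⟨c, hc⟩ := (MulAction.orbitRel_apply).1 (Quotient.exact (hqρ u).symm)
    exact ⟨c, hc.symm⟩
  have hρv : ρ v = v := by simp [ρ]
  have hρ0 : ∀ u, u ≠ 0 → ρ u ≠ 0 := by
    intro u hu h0
    obtain ⟨c, hc⟩ := hc u
    rw [h0, smul_zero] at hc
    exact hu hc
  choose c hc using hc
  have hc' : ∀ u, u = (c u : 𝕜) • ρ u := hc
  let s : E → E → 𝕜 := fun u y => (starRingEnd 𝕜) (c u : 𝕜) * (‖ρ u‖ : 𝕜) * ψ (ρ u) y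
  have hnorm : ∀ u, ‖u‖ = ‖(c u : 𝕜)‖ * ‖ρ u‖ := fun u => by
    rw [← norm_smul, ← hc' u]
  have hself : ∀ u, s u u = (‖u‖ : 𝕜) ^ 2 := by
    intro u
    change (starRingEnd 𝕜) (c u : 𝕜) * (‖ρ u‖ : 𝕜) * ψ (ρ u) u = _
    have h1 : ψ (ρ u) u = (c u : 𝕜) * (‖ρ u‖ : 𝕜) := by
      rw [congrArg (ψ (ρ u)) (hc' u), map_smul, (hψ (ρ u)).2, smul_eq_mul]
    rw [h1, hnorm u]
    push_cast
    calc _ = ((starRingEnd 𝕜) (c u : 𝕜) * (c u : 𝕜)) * (‖ρ u‖ : 𝕜) ^ 2 := by ring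
      _ = _ := by rw [RCLike.conj_mul]; ring
  refine ⟨s, ⟨hself, ?_, ?_, ?_⟩, ?_⟩
  · intro u y z a
    simp only [s, map_add, map_smul, smul_eq_mul]; ring
  · intro a u y
    rcases eq_or_ne a 0 with rfl | ha
    · have h0 : ρ ((0 : 𝕜) • u) = 0 := by
        have h1 := hc' ((0 : 𝕜) • u)
        rw [zero_smul] at h1 ⊢
        exact (smul_eq_zero.1 h1.symm).resolve_left (c 0).ne_zero
      simp only [s, h0]; simp
    · rcases eq_or_ne u 0 with rfl | hu
      · have h0 : ρ (0 : E) = 0 := by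
          have h1 := hc' (0 : E)
          exact (smul_eq_zero.1 h1.symm).resolve_left (c 0).ne_zero
        simp only [s, smul_zero, h0]; simp
      · have hq : q (a • u) = q u :=
          Quotient.sound (MulAction.orbitRel_apply.2 ⟨Units.mk0 a ha, rfl⟩)
        have hr := hρ _ _ hq
        have hca : (c (a • u) : 𝕜) = a * c u := by
          have h1 := hc' (a • u)
          rw [hr] at h1
          have h2 : a • u = (a * (c u : 𝕜)) • ρ u := by
            conv_lhs => rw [hc' u]
            rw [smul_smul]
          exact smul_left_injective 𝕜 (hρ0 u hu) (h1.symm.trans h2)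
        simp only [s, hr, hca, map_mul]; ring
  · intro u y
    rw [hself, hself]
    have h1 : ‖s u y‖ ≤ ‖u‖ * ‖y‖ := by
      simp only [s, norm_mul, RCLike.norm_conj, RCLike.norm_ofReal, abs_norm]
      rw [← hnorm u]
      gcongr
      exact (hψ _).norm_apply_le y
    simp only [norm_pow, RCLike.norm_ofReal, abs_norm]
    calc ‖s u y‖ ^ 2 ≤ (‖u‖ * ‖y‖) ^ 2 := by gcongr
      _ = _ := by ring
  · intro y
    have hcv : (c v : 𝕜) = 1 := by
      have h1 := hc' v
      rw [hρv] at h1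
      exact smul_left_injective 𝕜 hv (by simpa using h1.symm)
    simp only [s, hρv, hcv, hψv v rfl]; simp

end SemiInnerProduct

/-! ### Norming functionals and orthogonality in an `ℓᵖ` sum. -/

section LpDual

variable {𝕜 : Type*} [RCLike 𝕜] {ι : Type*} {X : ι → Type*}
  [∀ n, NormedAddCommGroup (X n)] [∀ n, NormedSpace 𝕜 (X n)] {p : ℝ≥0∞}

theorem lp.norm_add_single_rpow [DecidableEq ι] (hp : 0 < p.toReal) (x : lp X p) (n : ι)
    (w : X n) :
    ‖x + lp.single p n w‖ ^ p.toReal =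
      ‖x‖ ^ p.toReal - ‖x n‖ ^ p.toReal + ‖x n + w‖ ^ p.toReal := by
  have h1 := (lp.hasSum_norm hp x).update n (‖x n + w‖ ^ p.toReal)
  have h2 := lp.hasSum_norm hp (x + lp.single p n w)
  have h3 : (fun i => ‖(x + lp.single p n w) i‖ ^ p.toReal) =
      Function.update (fun i => ‖x i‖ ^ p.toReal) n (‖x n + w‖ ^ p.toReal) := by
    ext i
    rcases eq_or_ne i n with rfl | hi
    · simp
    · simp [hi]
  rw [h3] at h2
  rw [h2.unique h1]; ring

/-- The function bounds the norm after a coordinate of norm `a` is moved by `t` times a vector of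
norm `b`. Its slope at `0` will bound a norming functional on that coordinate. -/
theorem hasDerivAt_rpow_norm_perturbation {r N a b : ℝ} (hr : 1 < r) (hN : 0 < N) :
    HasDerivAt (fun t : ℝ => (N ^ r - a ^ r + (a + t * b) ^ r) ^ (1 / r))
      (N ^ (1 - r) * a ^ (r - 1) * b) 0 := by
  have h1 : HasDerivAt (fun t : ℝ => a + t * b) b 0 := by
    simpa using ((hasDerivAt_id (0 : ℝ)).mul_const b).const_add a
  have h2 : HasDerivAt (fun t : ℝ => N ^ r - a ^ r + (a + t * b) ^ r)
      (b * r * (a + 0 * b) ^ (r - 1)) 0 := (h1.rpow_const (Or.inr hr.le)).const_add _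
  have hval : N ^ r - a ^ r + (a + 0 * b) ^ r = N ^ r := by simp
  have h3 := h2.rpow_const (p := 1 / r) (Or.inl (by
    rw [hval]; exact (Real.rpow_pos_of_pos hN r).ne'))
  rw [hval] at h3
  convert h3 using 1
  rw [← Real.rpow_mul hN.le]
  have hr0 : r ≠ 0 := by positivity
  have : r * (1 / r - 1) = 1 - r := by field_simp
  rw [this]
  simp only [zero_mul, add_zero]
  field_simp

theorem le_of_hasDerivAt_of_forall_pos {φ : ℝ → ℝ} {c d : ℝ} (h : HasDerivAt φ d 0)
    (hle : ∀ t, 0 < t → φ 0 + t * c ≤ φ t) : c ≤ d := by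
  have h1 : Filter.Tendsto (fun t => t⁻¹ * (φ t - φ 0)) (nhdsWithin 0 (Set.Ioi 0)) (nhds d) := by
    have := (hasDerivAt_iff_tendsto_slope_zero.1 h)
    simp only [zero_add, smul_eq_mul] at this
    exact this.mono_left (nhdsWithin_mono _ fun t (ht : 0 < t) => ht.ne')
  refine ge_of_tendsto h1 ?_
  filter_upwards [self_mem_nhdsWithin] with t ht
  have ht' : 0 < t := ht
  rw [le_inv_mul_iff₀ ht']
  linarith [hle t ht']

variable [Fact (1 ≤ p)]

/-- Restricted to a coordinate, a norming functional of `x` on an `ℓᵖ` sum is bounded by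
`‖x‖ ^ (1 - p) * ‖x n‖ ^ (p - 1)`. -/
theorem IsNorming.norm_apply_single_le [DecidableEq ι] (hp : 1 < p.toReal) {x : lp X p}
    (hx : x ≠ 0) {F : lp X p →L[𝕜] 𝕜} (hF : IsNorming x F) (n : ι) (v : X n) :
    ‖F (lp.single p n v)‖ ≤ ‖x‖ ^ (1 - p.toReal) * ‖x n‖ ^ (p.toReal - 1) * ‖v‖ := by
  have hp0 : 0 < p.toReal := by linarith
  have key : ∀ w : X n, RCLike.re (F (lp.single p n w)) ≤
      ‖x‖ ^ (1 - p.toReal) * ‖x n‖ ^ (p.toReal - 1) * ‖w‖ := by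
    intro w
    refine le_of_hasDerivAt_of_forall_pos
      (hasDerivAt_rpow_norm_perturbation (a := ‖x n‖) (b := ‖w‖) hp (norm_pos_iff.2 hx)) ?_
    intro t ht
    have h1 : RCLike.re (F (x + lp.single p n ((t : 𝕜) • w))) =
        ‖x‖ + t * RCLike.re (F (lp.single p n w)) := by
      rw [map_add, hF.2, lp.single_smul, map_smul, map_add, smul_eq_mul, RCLike.re_ofReal_mul,
        RCLike.ofReal_re]
    have h2 : ‖x + lp.single p n ((t : 𝕜) • w)‖ ≤
        (‖x‖ ^ p.toReal - ‖x n‖ ^ p.toReal + (‖x n‖ + t * ‖w‖) ^ p.toReal) ^ (1 / p.toReal) := by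
      rw [← Real.rpow_rpow_inv (norm_nonneg (x + lp.single p n ((t : 𝕜) • w))) hp0.ne', one_div,
        lp.norm_add_single_rpow hp0]
      have h4 : ‖x n‖ ^ p.toReal ≤ ‖x‖ ^ p.toReal := by
        gcongr
        exact lp.norm_apply_le_norm (zero_lt_one.trans_le Fact.out).ne' x n
      have h5 : ‖x n + (t : 𝕜) • w‖ ≤ ‖x n‖ + t * ‖w‖ := by
        refine (norm_add_le _ _).trans_eq ?_
        rw [norm_smul, RCLike.norm_ofReal, abs_of_pos ht]
      have h6 : 0 ≤ ‖x n + (t : 𝕜) • w‖ ^ p.toReal := by positivity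
      gcongr
    have h3 : (‖x‖ ^ p.toReal - ‖x n‖ ^ p.toReal + (‖x n‖ + 0 * ‖w‖) ^ p.toReal) ^
        (1 / p.toReal) = ‖x‖ := by
      rw [zero_mul, add_zero, sub_add_cancel, one_div, Real.rpow_rpow_inv (norm_nonneg _) hp0.ne']
    simp only [h3]
    rw [← h1]
    exact (RCLike.re_le_norm _).trans ((hF.norm_apply_le _).trans h2)
  obtain ⟨c, hc, hcF⟩ := RCLike.exists_norm_eq_mul_self (F (lp.single p n v))
  have := key (c • v)
  rw [lp.single_smul, map_smul, smul_eq_mul, ← hcF, norm_smul, hc, one_mul,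
    RCLike.ofReal_re] at this
  exact this

/-- The coordinatewise upper bounds sum to exactly `‖x‖ = F x`, so none of them can be strict, and
equality of real part with modulus makes each value real. -/
theorem IsNorming.apply_single_eq [DecidableEq ι] (hp : 1 < p.toReal) (hp_top : p ≠ ⊤)
    {x : lp X p} (hx : x ≠ 0) {F : lp X p →L[𝕜] 𝕜} (hF : IsNorming x F) (n : ι) :
    F (lp.single p n (x n)) = ((‖x‖ ^ (1 - p.toReal) * ‖x n‖ ^ p.toReal : ℝ) : 𝕜) := by
  have hp0 : 0 < p.toReal := by linarith
  have hxn : 0 < ‖x‖ := norm_pos_iff.2 hx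
  have hpow : ∀ a : ℝ, 0 ≤ a → a ^ (p.toReal - 1) * a = a ^ p.toReal := by
    intro a ha
    rw [← Real.rpow_add_one' ha (by simpa using hp0.ne'), sub_add_cancel]
  have hle : ∀ i, ‖F (lp.single p i (x i))‖ ≤ ‖x‖ ^ (1 - p.toReal) * ‖x i‖ ^ p.toReal := by
    intro i
    have := hF.norm_apply_single_le hp hx i (x i)
    rwa [mul_assoc, hpow _ (norm_nonneg _)] at this
  have h1 : HasSum (fun i => RCLike.re (F (lp.single p i (x i)))) ‖x‖ := by
    have h := RCLike.hasSum_re 𝕜 (F.hasSum (lp.hasSum_single hp_top x))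
    rwa [hF.2, RCLike.ofReal_re] at h
  have h2 : HasSum (fun i => ‖x‖ ^ (1 - p.toReal) * ‖x i‖ ^ p.toReal) ‖x‖ := by
    have h := (lp.hasSum_norm hp0 x).mul_left (‖x‖ ^ (1 - p.toReal))
    rwa [← Real.rpow_add hxn, sub_add_cancel, Real.rpow_one] at h
  have h3 := h2.sub h1
  rw [sub_self, hasSum_zero_iff_of_nonneg
    (fun i => sub_nonneg.2 ((RCLike.re_le_norm _).trans (hle i)))] at h3
  have h4 : ‖x‖ ^ (1 - p.toReal) * ‖x n‖ ^ p.toReal = RCLike.re (F (lp.single p n (x n))) :=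
    sub_eq_zero.1 (congrFun h3 n)
  have h5 : ‖F (lp.single p n (x n))‖ ≤ RCLike.re (F (lp.single p n (x n))) := h4 ▸ hle n
  have h6 := RCLike.norm_le_re_iff_eq_norm.1 h5
  rw [h4, ← le_antisymm h5 (RCLike.re_le_norm _)]
  exact h6

/-- Birkhoff orthogonality in an `ℓᵖ` sum, in terms of norming functionals of the coordinates. -/
theorem lp.birkhoffOrthogonal_iff (hp : 1 < p.toReal) (hp_top : p ≠ ⊤) {x y : lp X p} :
    BirkhoffOrthogonal 𝕜 x y ↔ ∃ f : ∀ n, X n →L[𝕜] 𝕜, (∀ n, IsNorming (x n) (f n)) ∧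
      HasSum (fun n => ((‖x n‖ ^ (p.toReal - 1) : ℝ) : 𝕜) * f n (y n)) 0 := by
  classical
  have hp0 : 0 < p.toReal := by linarith
  have hpow : ∀ a : ℝ, 0 ≤ a → a ^ (p.toReal - 1) * a = a ^ p.toReal := by
    intro a ha
    rw [← Real.rpow_add_one' ha (by simpa using hp0.ne'), sub_add_cancel]
  constructor
  · intro h
    rcases eq_or_ne x 0 with rfl | hx
    · refine ⟨fun _ => 0, fun n => ⟨by simp, by simp⟩, ?_⟩
      simp
    obtain ⟨F, hF, hFy⟩ := birkhoffOrthogonal_iff_exists_isNorming.1 h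
    have hN : 0 < ‖x‖ := norm_pos_iff.2 hx
    have hNN : ‖x‖ ^ (p.toReal - 1) * ‖x‖ ^ (1 - p.toReal) = 1 := by
      rw [← Real.rpow_add hN]; simp
    -- The factor normalizes the restriction of `F` to a coordinate. Where `x n = 0` the inverse is
    -- `0`, and the zero functional is norming at `0`.
    let κ : ι → ℝ := fun n => ‖x‖ ^ (p.toReal - 1) * (‖x n‖ ^ (p.toReal - 1))⁻¹
    have hκ : ∀ n, 0 ≤ κ n := fun n => by positivity
    refine ⟨fun n => ((κ n : ℝ) : 𝕜) • F.comp (lp.singleContinuousLinearMap 𝕜 X p n),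
      fun n => ⟨?_, ?_⟩, ?_⟩
    · refine ContinuousLinearMap.opNorm_le_bound _ zero_le_one fun v => ?_
      change ‖(κ n : 𝕜) * F (lp.single p n v)‖ ≤ _
      rw [norm_mul, RCLike.norm_ofReal, abs_of_nonneg (hκ n)]
      calc κ n * ‖F (lp.single p n v)‖
          ≤ κ n * (‖x‖ ^ (1 - p.toReal) * ‖x n‖ ^ (p.toReal - 1) * ‖v‖) :=
            mul_le_mul_of_nonneg_left (hF.norm_apply_single_le hp hx n v) (hκ n)
        _ = (‖x‖ ^ (p.toReal - 1) * ‖x‖ ^ (1 - p.toReal)) *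
            ((‖x n‖ ^ (p.toReal - 1))⁻¹ * ‖x n‖ ^ (p.toReal - 1)) * ‖v‖ := by
            simp only [κ]; ring
        _ ≤ 1 * ‖v‖ := by
            rw [hNN, one_mul]
            gcongr
            exact inv_mul_le_one
    · change (κ n : 𝕜) * F (lp.single p n (x n)) = _
      rw [hF.apply_single_eq hp hp_top hx n, ← RCLike.ofReal_mul]
      congr 1
      rcases eq_or_ne (x n) 0 with h0 | h0
      · simp [h0, Real.zero_rpow hp0.ne']
      have h1 : ‖x n‖ ^ (p.toReal - 1) ≠ 0 :=
        (Real.rpow_pos_of_pos (norm_pos_iff.2 h0) _).ne'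
      calc _ = (‖x‖ ^ (p.toReal - 1) * ‖x‖ ^ (1 - p.toReal)) *
            ((‖x n‖ ^ (p.toReal - 1))⁻¹ * ‖x n‖ ^ (p.toReal - 1)) * ‖x n‖ := by
            rw [← hpow _ (norm_nonneg (x n))]; simp only [κ]; ring
        _ = ‖x n‖ := by rw [hNN, inv_mul_cancel₀ h1]; ring
    · have h1 := (F.hasSum (lp.hasSum_single hp_top y)).mul_left ((‖x‖ ^ (p.toReal - 1) : ℝ) : 𝕜)
      rw [hFy, mul_zero] at h1
      refine h1.congr_fun fun n => ?_
      change _ * ((κ n : 𝕜) * F (lp.single p n (y n))) = _ * F (lp.single p n (y n))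
      rcases eq_or_ne (x n) 0 with h0 | h0
      · have h2 := hF.norm_apply_single_le hp hx n (y n)
        rw [norm_eq_zero.2 h0, Real.zero_rpow (by linarith), mul_zero, zero_mul, norm_le_zero_iff] at h2
        rw [h2]; simp
      have h1 : ‖x n‖ ^ (p.toReal - 1) ≠ 0 :=
        (Real.rpow_pos_of_pos (norm_pos_iff.2 h0) _).ne'
      rw [← mul_assoc, ← RCLike.ofReal_mul]
      congr 2
      simp only [κ]; field_simp
  · rintro ⟨f, hf, hsum⟩ c
    have h1 : HasSum (fun n => ((‖x n‖ ^ (p.toReal - 1) : ℝ) : 𝕜) * f n ((x + c • y) n))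
        ((‖x‖ ^ p.toReal : ℝ) : 𝕜) := by
      have h2 : HasSum (fun n => ((‖x n‖ ^ p.toReal : ℝ) : 𝕜)) ((‖x‖ ^ p.toReal : ℝ) : 𝕜) :=
        (RCLike.hasSum_ofReal 𝕜).2 (lp.hasSum_norm hp0 x)
      have h3 := h2.add (hsum.mul_left c)
      rw [mul_zero, add_zero] at h3
      refine h3.congr_fun fun n => ?_
      rw [lp.coeFn_add, Pi.add_apply, lp.coeFn_smul, Pi.smul_apply, map_add, map_smul, (hf n).2,
        mul_add, ← RCLike.ofReal_mul, hpow _ (norm_nonneg _), smul_eq_mul]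
      ring
    have h2 := RCLike.hasSum_re 𝕜 h1
    rw [RCLike.ofReal_re] at h2
    -- Young's inequality in each coordinate, summed, gives `‖x‖ ^ p ≤ ‖x‖ ^ p / q + ‖x + c • y‖ ^ p
    -- / p` with `q` the conjugate exponent.
    have hq := Real.HolderConjugate.conjExponent hp
    have hq' : (p.toReal - 1) * Real.conjExponent p.toReal = p.toReal := hq.sub_one_mul_conj
    have h3 := ((lp.hasSum_norm hp0 x).div_const (Real.conjExponent p.toReal)).add
      ((lp.hasSum_norm hp0 (x + c • y)).div_const p.toReal)
    have h4 := hasSum_le (fun n => ?_) h2 h3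
    · have h5 : ‖x‖ ^ p.toReal / p.toReal ≤ ‖x + c • y‖ ^ p.toReal / p.toReal := by
        have h6 : ‖x‖ ^ p.toReal = ‖x‖ ^ p.toReal / p.toReal +
            ‖x‖ ^ p.toReal / Real.conjExponent p.toReal := by
          have := hq.inv_add_inv_eq_one
          rw [div_eq_mul_inv, div_eq_mul_inv, ← mul_add, this, mul_one]
        linarith
      have h6 := (div_le_div_iff_of_pos_right hp0).1 h5
      exact (Real.rpow_le_rpow_iff (norm_nonneg _) (norm_nonneg _) hp0).1 h6
    · calc RCLike.re (((‖x n‖ ^ (p.toReal - 1) : ℝ) : 𝕜) * f n ((x + c • y) n))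
          ≤ ‖((‖x n‖ ^ (p.toReal - 1) : ℝ) : 𝕜) * f n ((x + c • y) n)‖ := RCLike.re_le_norm _
        _ ≤ ‖x n‖ ^ (p.toReal - 1) * ‖(x + c • y) n‖ := by
            rw [norm_mul, RCLike.norm_ofReal, abs_of_nonneg (by positivity)]
            gcongr
            exact (hf n).norm_apply_le _
        _ ≤ (‖x n‖ ^ (p.toReal - 1)) ^ Real.conjExponent p.toReal / Real.conjExponent p.toReal +
            ‖(x + c • y) n‖ ^ p.toReal / p.toReal :=
            Real.young_inequality_of_nonneg (by positivity) (norm_nonneg _) hq.symm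
        _ = _ := by rw [← Real.rpow_mul (norm_nonneg _), hq']

end LpDual

/-! ### From related norming functionals to smoothness and s.i.p. symmetry. -/

section Smooth

variable {𝕜 : Type*} [RCLike 𝕜] {E : Type*} [NormedAddCommGroup E] [NormedSpace 𝕜 E]

/-- The relation between a norming functional `f` of `x` and a norming functional `h` of `v`
that underlies `p`-s.i.p. symmetry. -/
def SipRelated (p : ℝ) (x v : E) (f h : E →L[𝕜] 𝕜) : Prop :=
  ((‖v‖ ^ (p - 1) : ℝ) : 𝕜) * h x = ((‖f v‖ ^ (p - 2) : ℝ) : 𝕜) * (starRingEnd 𝕜) (f v) * (‖x‖ : 𝕜)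

theorem SipRelated.mul_eq_sipTwist {p : ℝ} {x v : E} (hx : x ≠ 0) (hv : v ≠ 0)
    {f h : E →L[𝕜] 𝕜} (H : SipRelated p x v f h) :
    (‖v‖ : 𝕜) * h x = sipTwist 𝕜 p x v ((‖x‖ : 𝕜) * f v) := by
  have hx0 : 0 < ‖x‖ := norm_pos_iff.2 hx
  have hv0 : 0 < ‖v‖ := norm_pos_iff.2 hv
  unfold sipTwist
  have h1 : ‖(‖x‖ : 𝕜) * f v‖ / (‖x‖ * ‖v‖) = ‖f v‖ / ‖v‖ := by
    rw [norm_mul, RCLike.norm_ofReal, abs_norm]; field_simp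
  have h2 : ‖v‖ ^ (p - 1) = ‖v‖ ^ (p - 2) * ‖v‖ := by
    rw [← Real.rpow_add_one hv0.ne']; congr 1; ring
  have h3 : ((‖v‖ ^ (p - 2) : ℝ) : 𝕜) ≠ 0 := by
    simpa using (Real.rpow_pos_of_pos hv0 (p - 2)).ne'
  unfold SipRelated at H
  rw [h2, RCLike.ofReal_mul] at H
  rw [h1, Real.div_rpow (norm_nonneg _) hv0.le, map_mul, RCLike.conj_ofReal, RCLike.ofReal_div]
  field_simp
  linear_combination H

/-- Along `t = 2 ^ (-n)` the difference quotient `(N t - A) / t` is non-negative, yet each halving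
of `t` lowers it by at least the fixed amount `c / 2`. -/
theorem not_forall_two_mul_sub_le {N : ℝ → ℝ} {A c : ℝ} (hc : 0 < c) (hN : ∀ t, A ≤ N t)
    (h : ∀ t, 0 < t → t < 1 → 2 * N t - N (2 * t) ≤ A - c * t) : False := by
  have key : ∀ n : ℕ, 2 ^ n * (N ((1 / 2) ^ n) - A) ≤ N 1 - A - n * (c / 2) := by
    intro n
    induction n with
    | zero => simp
    | succ n ih =>
      have h1 := h ((1 / 2) ^ (n + 1)) (by positivity)
        (pow_lt_one₀ (by norm_num) (by norm_num) (by omega))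
      have h2 : 2 * (1 / 2 : ℝ) ^ (n + 1) = (1 / 2) ^ n := by rw [pow_succ]; ring
      have h3 : (2 : ℝ) ^ n * (1 / 2 : ℝ) ^ (n + 1) = 1 / 2 := by
        rw [pow_succ, ← mul_assoc, ← mul_pow]; norm_num
      rw [h2] at h1
      have h4 := mul_le_mul_of_nonneg_left h1 (by positivity : (0 : ℝ) ≤ 2 ^ n)
      push_cast
      rw [pow_succ (2 : ℝ)]
      have h5 : (2 : ℝ) ^ n * (A - c * (1 / 2) ^ (n + 1)) = 2 ^ n * A - c * (1 / 2) := by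
        linear_combination (-c) * h3
      rw [h5] at h4
      linarith
  obtain ⟨n, hn⟩ := exists_nat_gt ((N 1 - A) / (c / 2))
  have h1 := key n
  have h2 : 0 ≤ 2 ^ n * (N ((1 / 2) ^ n) - A) :=
    mul_nonneg (by positivity) (sub_nonneg.2 (hN _))
  rw [div_lt_iff₀ (by positivity)] at hn
  linarith

/-- Bernoulli's inequality gives `c = r` for `r ≤ 1`; for `r ≥ 1` the base below `1` gives `c = 1`.
Both cases occur for `r = p - 1`. -/
theorem exists_one_sub_rpow_le {r : ℝ} (hr : 0 < r) :
    ∃ c, 0 < c ∧ ∀ t : ℝ, 0 < t → t < 1 → (1 - t) ^ r ≤ 1 - c * t := by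
  rcases le_total r 1 with h | h
  · refine ⟨r, hr, fun t ht ht1 => ?_⟩
    have := rpow_one_add_le_one_add_mul_self (s := -t) (by linarith) hr.le h
    calc (1 - t) ^ r = (1 + -t) ^ r := by ring_nf
      _ ≤ _ := this
      _ = _ := by ring
  · refine ⟨1, one_pos, fun t ht ht1 => ?_⟩
    calc (1 - t) ^ r ≤ (1 - t) ^ (1 : ℝ) :=
          Real.rpow_le_rpow_of_exponent_ge (by linarith) (by linarith) h
      _ = _ := by simp

/-- If every norming functional of `x` is related to some norming functional of every `v`,
then `x` is smooth. -/
theorem isSmoothPoint_of_forall_sipRelated {p : ℝ} (hp : 1 < p) {x : E} (hx : x ≠ 0)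
    (H : ∀ v f, IsNorming x f → ∃ h : E →L[𝕜] 𝕜, IsNorming v h ∧ SipRelated p x v f h) :
    IsSmoothPoint 𝕜 x := by
  have hA : 0 < ‖x‖ := norm_pos_iff.2 hx
  have hA' : (‖x‖ : 𝕜) ≠ 0 := by simpa using hx
  refine ⟨hx, ?_⟩
  simp only [isSupportFunctional_iff_isNorming hx]
  obtain ⟨g, hg⟩ := exists_isNorming 𝕜 x
  refine ⟨g, hg, fun f hf => ?_⟩
  by_contra hfg
  obtain ⟨u, hu⟩ : ∃ u, f u ≠ g u := by
    by_contra hcon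
    push Not at hcon
    exact hfg (ContinuousLinearMap.ext hcon)
  -- The vector `w` is a multiple of the projection of `u` onto the kernel of `g` along `x`. Then
  -- `g` keeps `‖x + t • w‖ ≥ ‖x‖`, while `f` shrinks linearly along `w`.
  obtain ⟨w, hgw, hfw⟩ : ∃ w, g w = 0 ∧ f w = -(‖x‖ : 𝕜) := by
    have hne : f u - g u ≠ 0 := sub_ne_zero.2 hu
    refine ⟨(-(‖x‖ : 𝕜) / (f u - g u)) • (u - (g u / (‖x‖ : 𝕜)) • x), ?_, ?_⟩
    · simp only [map_smul, map_sub, hg.2, smul_eq_mul]; field_simp; simp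
    · simp only [map_smul, map_sub, hf.2, smul_eq_mul]; field_simp
  obtain ⟨c, hc, hcle⟩ := exists_one_sub_rpow_le (r := p - 1) (by linarith)
  refine not_forall_two_mul_sub_le (N := fun t => ‖x + (t : 𝕜) • w‖) (A := ‖x‖)
    (c := ‖x‖ * c) (by positivity) (fun t => ?_) (fun t ht ht1 => ?_)
  · have := hg.norm_apply_le (x + (t : 𝕜) • w)
    simpa [hgw, hg.2] using this
  have hNA : ‖x‖ ≤ ‖x + (t : 𝕜) • w‖ := by
    have := hg.norm_apply_le (x + (t : 𝕜) • w)
    simpa [hgw, hg.2] using this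
  obtain ⟨h, hh, hrel⟩ := H (x + (t : 𝕜) • w) f hf
  set v := x + (t : 𝕜) • w with hv
  have hfv : f v = ((‖x‖ * (1 - t) : ℝ) : 𝕜) := by
    rw [hv, map_add, map_smul, hf.2, hfw, smul_eq_mul]; push_cast; ring
  have h1t : 0 < 1 - t := by linarith
  have hv0 : 0 < ‖v‖ := hA.trans_le hNA
  have hre : ‖v‖ ^ (p - 1) * RCLike.re (h x) = (‖x‖ * (1 - t)) ^ (p - 1) * ‖x‖ := by
    unfold SipRelated at hrel
    rw [hfv, RCLike.conj_ofReal, RCLike.norm_ofReal, abs_of_pos (by positivity),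
      ← RCLike.ofReal_mul, ← RCLike.ofReal_mul, ← Real.rpow_add_one (by positivity)] at hrel
    have := congrArg RCLike.re hrel
    rw [RCLike.re_ofReal_mul, RCLike.ofReal_re] at this
    rw [this]; congr 2; ring
  have hle : RCLike.re (h x) ≤ ‖x‖ * (1 - t) ^ (p - 1) := by
    rw [Real.mul_rpow hA.le h1t.le] at hre
    have h1 : ‖x‖ ^ (p - 1) ≤ ‖v‖ ^ (p - 1) :=
      Real.rpow_le_rpow hA.le hNA (by linarith)
    have h2 : 0 < ‖v‖ ^ (p - 1) := Real.rpow_pos_of_pos hv0 _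
    refine le_of_mul_le_mul_left ?_ h2
    rw [hre]
    have h3 : 0 ≤ ‖x‖ * (1 - t) ^ (p - 1) := by positivity
    nlinarith
  -- Since `x = 2 • v - (x + 2t • w)` and `h` is norming at `v`, the relation for `h` turns into the
  -- doubling inequality excluded above.
  have hge : 2 * ‖v‖ - ‖x + ((2 * t : ℝ) : 𝕜) • w‖ ≤ RCLike.re (h x) := by
    have h1 : h x = 2 * h v - h (x + ((2 * t : ℝ) : 𝕜) • w) := by
      rw [hv]; simp only [map_add, map_smul, smul_eq_mul]; push_cast; ring
    have h2 := (RCLike.re_le_norm (h (x + ((2 * t : ℝ) : 𝕜) • w))).trans (hh.norm_apply_le _)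
    have h3 : RCLike.re (2 * h v) = 2 * ‖v‖ := by
      rw [hh.2, ← RCLike.ofReal_ofNat 2, ← RCLike.ofReal_mul, RCLike.ofReal_re]
    rw [h1, map_sub, h3]
    linarith
  have h4 := mul_le_mul_of_nonneg_left (hcle t ht ht1) hA.le
  change 2 * ‖v‖ - ‖x + ((2 * t : ℝ) : 𝕜) • w‖ ≤ _
  nlinarith

theorem isLeftSipSymmetric_of_forall_sipRelated {p : ℝ} {x : E} (hx : x ≠ 0)
    (H : ∀ v f, IsNorming x f → ∃ h : E →L[𝕜] 𝕜, IsNorming v h ∧ SipRelated p x v f h) :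
    IsLeftSipSymmetric 𝕜 p x := by
  intro v hv s hs
  obtain ⟨f, hf, hsf⟩ := hs.exists_isNorming hx
  obtain ⟨h, hh, hrel⟩ := H v f hf
  obtain ⟨s', hs', hs'h⟩ := hh.exists_isSemiInnerProduct hv
  exact ⟨s', hs', by rw [hs'h, hsf, hrel.mul_eq_sipTwist hx hv]⟩

theorem isRightSipSymmetric_of_forall_sipRelated {p : ℝ} {x : E} (hx : x ≠ 0)
    (H : ∀ v (h : E →L[𝕜] 𝕜), IsNorming v h → ∃ f, IsNorming x f ∧ SipRelated p x v f h) :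
    IsRightSipSymmetric 𝕜 p x := by
  intro v hv s hs
  obtain ⟨h, hh, hsh⟩ := hs.exists_isNorming hv
  obtain ⟨f, hf, hrel⟩ := H v h hh
  obtain ⟨s', hs', hs'f⟩ := hf.exists_isSemiInnerProduct hx
  exact ⟨s', hs', by rw [hs'f, hsh, hrel.mul_eq_sipTwist hx hv]⟩

end Smooth

/-! ### Weighted multiples of `x`: equal norms and at most two non-zero coordinates. -/

section Scaling

variable {𝕜 : Type*} [RCLike 𝕜]

theorem hasSum_zero_iff_sum_eq_zero {ι : Type*} {g : ι → 𝕜} {s : Finset ι}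
    (hg : ∀ n ∉ s, g n = 0) : HasSum g 0 ↔ ∑ n ∈ s, g n = 0 := by
  have h : HasSum g (∑ n ∈ s, g n) := hasSum_sum_of_ne_finset_zero hg
  exact ⟨fun h0 => h.unique h0, fun h0 => h0 ▸ h⟩

theorem IsNorming.rpow_mul_apply_of_smul {E : Type*} [NormedAddCommGroup E] [NormedSpace 𝕜 E]
    {r : ℝ} (hr : 1 < r) {x : E} {t : 𝕜} {f : E →L[𝕜] 𝕜} (hf : IsNorming (t • x) f) :
    ((‖t • x‖ ^ (r - 1) : ℝ) : 𝕜) * f x =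
      ((‖t‖ ^ (r - 2) : ℝ) : 𝕜) * (starRingEnd 𝕜) t * ((‖x‖ ^ r : ℝ) : 𝕜) := by
  rcases eq_or_ne t 0 with rfl | ht
  · simp [Real.zero_rpow (show r - 1 ≠ 0 by linarith)]
  have h := hf.norm_mul_apply_of_smul
  have h1 : ‖t‖ ^ (r - 1) = ‖t‖ ^ (r - 2) * ‖t‖ := by
    rw [← Real.rpow_add_one (norm_ne_zero_iff.2 ht)]; congr 1; ring
  have h2 : ‖x‖ ^ r = ‖x‖ ^ (r - 1) * ‖x‖ := by
    rw [← Real.rpow_add_one' (norm_nonneg x) (by linarith)]; congr 1; ring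
  rw [norm_smul, Real.mul_rpow (norm_nonneg _) (norm_nonneg _), h1, h2]
  push_cast
  linear_combination ((‖t‖ ^ (r - 2) : ℝ) : 𝕜) * ((‖x‖ ^ (r - 1) : ℝ) : 𝕜) * h

variable {ι : Type*} {X : ι → Type*} [∀ n, NormedAddCommGroup (X n)] [∀ n, NormedSpace 𝕜 (X n)]
  {p : ℝ≥0∞} [Fact (1 ≤ p)]

/-- On multiples of `x n` every norming functional takes the same value, so the existential over
functionals collapses to a real equation. -/
theorem lp.birkhoffOrthogonal_right_scaling_iff (hp : 1 < p.toReal) (hp_top : p ≠ ⊤)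
    {x y : lp X p} {s : Finset ι} {c : ι → ℝ} (hys : ∀ n ∈ s, y n = ((c n : ℝ) : 𝕜) • x n)
    (hy : ∀ n ∉ s, y n = 0) :
    BirkhoffOrthogonal 𝕜 x y ↔ ∑ n ∈ s, c n * ‖x n‖ ^ p.toReal = 0 := by
  have key : ∀ f : ∀ n, X n →L[𝕜] 𝕜, (∀ n, IsNorming (x n) (f n)) →
      (HasSum (fun n => ((‖x n‖ ^ (p.toReal - 1) : ℝ) : 𝕜) * f n (y n)) 0 ↔
        ∑ n ∈ s, c n * ‖x n‖ ^ p.toReal = 0) := by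
    intro f hf
    rw [hasSum_zero_iff_sum_eq_zero (s := s) (fun n hn => by simp [hy n hn]),
      ← RCLike.ofReal_eq_zero (K := 𝕜), RCLike.ofReal_sum,
      Finset.sum_congr rfl (fun n hn => ?_)]
    have h2 : ‖x n‖ ^ p.toReal = ‖x n‖ ^ (p.toReal - 1) * ‖x n‖ := by
      rw [← Real.rpow_add_one' (norm_nonneg _) (by linarith)]; congr 1; ring
    rw [hys n hn, map_smul, (hf n).2, h2, smul_eq_mul]
    push_cast; ring
  rw [lp.birkhoffOrthogonal_iff hp hp_top]
  constructor
  · rintro ⟨f, hf, hsum⟩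
    exact (key f hf).1 hsum
  · intro h
    choose f hf using fun n => exists_isNorming 𝕜 (x n)
    exact ⟨f, hf, (key f hf).2 h⟩

theorem lp.birkhoffOrthogonal_left_scaling_iff (hp : 1 < p.toReal) (hp_top : p ≠ ⊤)
    {x y : lp X p} {s : Finset ι} {c : ι → ℝ} (hys : ∀ n ∈ s, y n = ((c n : ℝ) : 𝕜) • x n)
    (hy : ∀ n ∉ s, y n = 0) :
    BirkhoffOrthogonal 𝕜 y x ↔
      ∑ n ∈ s, |c n| ^ (p.toReal - 2) * c n * ‖x n‖ ^ p.toReal = 0 := by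
  have key : ∀ f : ∀ n, X n →L[𝕜] 𝕜, (∀ n, IsNorming (y n) (f n)) →
      (HasSum (fun n => ((‖y n‖ ^ (p.toReal - 1) : ℝ) : 𝕜) * f n (x n)) 0 ↔
        ∑ n ∈ s, |c n| ^ (p.toReal - 2) * c n * ‖x n‖ ^ p.toReal = 0) := by
    intro f hf
    rw [hasSum_zero_iff_sum_eq_zero (s := s) (fun n hn => by
        simp [hy n hn, Real.zero_rpow (show p.toReal - 1 ≠ 0 by linarith)]),
      ← RCLike.ofReal_eq_zero (K := 𝕜), RCLike.ofReal_sum,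
      Finset.sum_congr rfl (fun n hn => ?_)]
    have h := hf n
    rw [hys n hn] at h ⊢
    rw [h.rpow_mul_apply_of_smul hp, RCLike.conj_ofReal, RCLike.norm_ofReal]
    push_cast; ring
  rw [lp.birkhoffOrthogonal_iff hp hp_top]
  constructor
  · rintro ⟨f, hf, hsum⟩
    exact (key f hf).1 hsum
  · intro h
    choose f hf using fun n => exists_isNorming 𝕜 (y n)
    exact ⟨f, hf, (key f hf).2 h⟩

theorem lp.exists_eq_on_finset (p : ℝ≥0∞) (s : Finset ι) (z : ∀ n, X n) :
    ∃ y : lp X p, (∀ n ∈ s, y n = z n) ∧ ∀ n ∉ s, y n = 0 := by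
  classical
  refine ⟨∑ i ∈ s, lp.single p i (z i), fun n hn => ?_, fun n hn => ?_⟩ <;>
  simp only [lp.coeFn_single, lp.coeFn_sum, Finset.sum_apply, Finset.sum_pi_single, hn, if_true,
    if_false]

theorem IsLeftSymmetric.sum_rpow_eq_zero (hp : 1 < p.toReal) (hp_top : p ≠ ⊤) {x : lp X p}
    (hx : IsLeftSymmetric 𝕜 x) (s : Finset ι) (c : ι → ℝ)
    (h : ∑ n ∈ s, c n * ‖x n‖ ^ p.toReal = 0) :
    ∑ n ∈ s, |c n| ^ (p.toReal - 2) * c n * ‖x n‖ ^ p.toReal = 0 := by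
  obtain ⟨y, hys, hy⟩ := lp.exists_eq_on_finset p s (fun n => ((c n : ℝ) : 𝕜) • x n)
  exact (lp.birkhoffOrthogonal_left_scaling_iff hp hp_top hys hy).1
    (hx y ((lp.birkhoffOrthogonal_right_scaling_iff hp hp_top hys hy).2 h))

theorem IsRightSymmetric.sum_eq_zero (hp : 1 < p.toReal) (hp_top : p ≠ ⊤) {x : lp X p}
    (hx : IsRightSymmetric 𝕜 x) (s : Finset ι) (c : ι → ℝ)
    (h : ∑ n ∈ s, |c n| ^ (p.toReal - 2) * c n * ‖x n‖ ^ p.toReal = 0) :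
    ∑ n ∈ s, c n * ‖x n‖ ^ p.toReal = 0 := by
  obtain ⟨y, hys, hy⟩ := lp.exists_eq_on_finset p s (fun n => ((c n : ℝ) : 𝕜) • x n)
  exact (lp.birkhoffOrthogonal_right_scaling_iff hp hp_top hys hy).1
    (hx y ((lp.birkhoffOrthogonal_left_scaling_iff hp hp_top hys hy).2 h))

theorem IsLeftSymmetric.norm_apply_eq (hp : 1 < p.toReal) (hp_top : p ≠ ⊤) (hp2 : p.toReal ≠ 2)
    {x : lp X p} (hx : IsLeftSymmetric 𝕜 x) {m k : ι} (hm : x m ≠ 0) (hk : x k ≠ 0) :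
    ‖x m‖ = ‖x k‖ := by
  classical
  rcases eq_or_ne m k with rfl | hmk
  · rfl
  have ha : 0 < ‖x m‖ ^ p.toReal := Real.rpow_pos_of_pos (norm_pos_iff.2 hm) _
  have hb : 0 < ‖x k‖ ^ p.toReal := Real.rpow_pos_of_pos (norm_pos_iff.2 hk) _
  -- Crossed weights cancel the plain sum; the twisted sum then equates the `(p - 2)`-th powers.
  have h := hx.sum_rpow_eq_zero hp hp_top {m, k}
    (fun n => if n = m then ‖x k‖ ^ p.toReal else -‖x m‖ ^ p.toReal) (by
      simp [Finset.sum_pair hmk, hmk.symm]; ring)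
  simp only [Finset.sum_pair hmk, if_pos, hmk.symm, if_false, abs_neg, abs_of_pos ha,
    abs_of_pos hb] at h
  have h1 : (‖x k‖ ^ p.toReal) ^ (p.toReal - 2) = (‖x m‖ ^ p.toReal) ^ (p.toReal - 2) := by
    have hab := (mul_pos ha hb).ne'
    apply mul_right_cancel₀ hab
    linear_combination h
  have h2 := Real.rpow_left_injOn (sub_ne_zero.2 hp2) hb.le ha.le h1
  exact (Real.rpow_left_injOn (by linarith : p.toReal ≠ 0) (norm_nonneg _) (norm_nonneg _) h2).symm

theorem two_rpow_ne_one {r : ℝ} (hr : r ≠ 0) : (2 : ℝ) ^ r ≠ 1 := by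
  intro h
  have h1 := congrArg Real.log h
  rw [Real.log_rpow two_pos, Real.log_one] at h1
  exact mul_ne_zero hr (Real.log_pos one_lt_two).ne' h1

theorem IsLeftSymmetric.apply_eq_zero (hp : 1 < p.toReal) (hp_top : p ≠ ⊤) (hp2 : p.toReal ≠ 2)
    {x : lp X p} (hx : IsLeftSymmetric 𝕜 x) {m k : ι} (hmk : m ≠ k) (hm : x m ≠ 0)
    (hk : x k ≠ 0) {n : ι} (hnm : n ≠ m) (hnk : n ≠ k) : x n = 0 := by
  classical
  by_contra hn
  have e1 := hx.norm_apply_eq hp hp_top hp2 hk hm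
  have e2 := hx.norm_apply_eq hp hp_top hp2 hn hm
  have ha : 0 < ‖x m‖ ^ p.toReal := Real.rpow_pos_of_pos (norm_pos_iff.2 hm) _
  have hsum : ∀ g : ι → ℝ, ∑ i ∈ ({m, k, n} : Finset ι), g i = g m + (g k + g n) := by
    intro g
    rw [Finset.sum_insert (by simp [hmk, hnm.symm]), Finset.sum_pair hnk.symm]
  -- With equal norms the weights `2, -1, -1` cancel, while the twisted sum would require `2 ^ (p -
  -- 2) = 1`.
  have h := hx.sum_rpow_eq_zero hp hp_top {m, k, n} (fun i => if i = m then 2 else -1) (by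
      rw [hsum]; simp only [if_pos, hmk.symm, hnm, if_false, e1, e2]; ring)
  rw [hsum] at h
  simp only [if_pos, hmk.symm, hnm, if_false, e1, e2, abs_neg, abs_one, Real.one_rpow,
    abs_two] at h
  refine two_rpow_ne_one (sub_ne_zero.2 hp2) (mul_right_cancel₀ ha.ne' ?_)
  linarith

/-- This inverts the twist `c ↦ |c| ^ (p - 2) * c` on positive reals. Right symmetry starts from the
twisted equation, so its test weights are such preimages. -/
theorem Real.rpow_sub_two_mul_self_rpow_inv {r a : ℝ} (hr : 1 < r) (ha : 0 < a) :
    (a ^ (r - 1)⁻¹) ^ (r - 2) * a ^ (r - 1)⁻¹ = a := by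
  rw [← Real.rpow_add_one (Real.rpow_pos_of_pos ha _).ne', show r - 2 + 1 = r - 1 by ring,
    Real.rpow_inv_rpow ha.le (by linarith)]

theorem IsRightSymmetric.norm_apply_eq (hp : 1 < p.toReal) (hp_top : p ≠ ⊤) (hp2 : p.toReal ≠ 2)
    {x : lp X p} (hx : IsRightSymmetric 𝕜 x) {m k : ι} (hm : x m ≠ 0) (hk : x k ≠ 0) :
    ‖x m‖ = ‖x k‖ := by
  classical
  rcases eq_or_ne m k with rfl | hmk
  · rfl
  set a := ‖x m‖ ^ p.toReal with hadef
  set b := ‖x k‖ ^ p.toReal with hbdef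
  have ha : 0 < a := Real.rpow_pos_of_pos (norm_pos_iff.2 hm) _
  have hb : 0 < b := Real.rpow_pos_of_pos (norm_pos_iff.2 hk) _
  set α := b ^ (p.toReal - 1)⁻¹ with hα
  set β := a ^ (p.toReal - 1)⁻¹ with hβ
  have hα0 : 0 < α := Real.rpow_pos_of_pos hb _
  have hβ0 : 0 < β := Real.rpow_pos_of_pos ha _
  have e1 : α ^ (p.toReal - 2) * α = b := Real.rpow_sub_two_mul_self_rpow_inv hp hb
  have e2 : β ^ (p.toReal - 2) * β = a := Real.rpow_sub_two_mul_self_rpow_inv hp ha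
  have h := hx.sum_eq_zero hp hp_top {m, k} (fun n => if n = m then α else -β) (by
      simp only [Finset.sum_pair hmk, if_pos, hmk.symm, if_false, abs_neg, abs_of_pos hα0,
        abs_of_pos hβ0]
      rw [← hadef, ← hbdef]
      linear_combination a * e1 - b * e2)
  simp only [Finset.sum_pair hmk, if_pos, hmk.symm, if_false] at h
  rw [← hadef, ← hbdef] at h
  have h1 : α ^ (p.toReal - 2) = β ^ (p.toReal - 2) := by
    apply mul_right_cancel₀ (mul_pos hα0 ha).ne'
    linear_combination a * e1 - b * e2 - β ^ (p.toReal - 2) * h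
  have h2 : α = β := Real.rpow_left_injOn (sub_ne_zero.2 hp2) hα0.le hβ0.le h1
  have h3 : a = b := by rw [← e1, ← e2, h2]
  exact Real.rpow_left_injOn (by linarith : p.toReal ≠ 0) (norm_nonneg _) (norm_nonneg _) h3

theorem IsRightSymmetric.apply_eq_zero (hp : 1 < p.toReal) (hp_top : p ≠ ⊤) (hp2 : p.toReal ≠ 2)
    {x : lp X p} (hx : IsRightSymmetric 𝕜 x) {m k : ι} (hmk : m ≠ k) (hm : x m ≠ 0)
    (hk : x k ≠ 0) {n : ι} (hnm : n ≠ m) (hnk : n ≠ k) : x n = 0 := by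
  classical
  by_contra hn
  have e1 := hx.norm_apply_eq hp hp_top hp2 hk hm
  have e2 := hx.norm_apply_eq hp hp_top hp2 hn hm
  have ha : 0 < ‖x m‖ ^ p.toReal := Real.rpow_pos_of_pos (norm_pos_iff.2 hm) _
  have hsum : ∀ g : ι → ℝ, ∑ i ∈ ({m, k, n} : Finset ι), g i = g m + (g k + g n) := by
    intro g
    rw [Finset.sum_insert (by simp [hmk, hnm.symm]), Finset.sum_pair hnk.symm]
  -- The twist of `α` is `2`, balancing two weights `-1`; the untwisted sum then gives `α = 2`.
  set α := (2 : ℝ) ^ (p.toReal - 1)⁻¹ with hα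
  have hα0 : 0 < α := Real.rpow_pos_of_pos two_pos _
  have e3 : α ^ (p.toReal - 2) * α = 2 := Real.rpow_sub_two_mul_self_rpow_inv hp two_pos
  have h := hx.sum_eq_zero hp hp_top {m, k, n} (fun i => if i = m then α else -1) (by
      rw [hsum]
      simp only [if_pos, hmk.symm, hnm, if_false, e1, e2, abs_neg, abs_one, Real.one_rpow,
        abs_of_pos hα0, e3]
      ring)
  rw [hsum] at h
  simp only [if_pos, hmk.symm, hnm, if_false, e1, e2] at h
  have h2 : α = 2 := mul_right_cancel₀ ha.ne' (by linarith)
  rw [h2] at e3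
  exact two_rpow_ne_one (sub_ne_zero.2 hp2) (by linarith)

end Scaling

/-! ### Vectors with two non-zero coordinates, and the one-coordinate case. -/

section TwoCoordinates

theorem lp.eq_single_of_forall_ne {ι : Type*} [DecidableEq ι] {X : ι → Type*}
    [∀ n, NormedAddCommGroup (X n)] {p : ℝ≥0∞} {x : lp X p} {n : ι} (hx : ∀ i, i ≠ n → x i = 0) :
    x = lp.single p n (x n) := by
  ext i
  rcases eq_or_ne i n with rfl | hi
  · simp
  · simp [hi, hx i hi]

variable {𝕜 : Type*} [RCLike 𝕜] {ι : Type*} {X : ι → Type*}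
  [∀ n, NormedAddCommGroup (X n)] [∀ n, NormedSpace 𝕜 (X n)] {p : ℝ≥0∞} [Fact (1 ≤ p)]

theorem lp.exists_eq_on_pair (p : ℝ≥0∞) {m k : ι} (hmk : m ≠ k) (v : X m) (w : X k) :
    ∃ y : lp X p, y m = v ∧ y k = w ∧ ∀ n, n ≠ m → n ≠ k → y n = 0 := by
  classical
  refine ⟨lp.single p m v + lp.single p k w, ?_, ?_, fun n hm hk => ?_⟩
  · simp [hmk]
  · simp [hmk.symm]
  · simp [hm, hk]

/-- At `k` the functional's value is forced and off the pair `y` vanishes, so only the functional on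
`X m` is a real choice. -/
theorem lp.birkhoffOrthogonal_right_pair_iff (hp : 1 < p.toReal) (hp_top : p ≠ ⊤) {x y : lp X p}
    {m k : ι} (hmk : m ≠ k) (hxk : x k ≠ 0) (hxmk : ‖x m‖ = ‖x k‖) {t : 𝕜}
    (hyk : y k = t • x k) (hy : ∀ n, n ≠ m → n ≠ k → y n = 0) :
    BirkhoffOrthogonal 𝕜 x y ↔
      ∃ f : X m →L[𝕜] 𝕜, IsNorming (x m) f ∧ f (y m) + t * (‖x m‖ : 𝕜) = 0 := by
  classical
  have hpos : ((‖x m‖ ^ (p.toReal - 1) : ℝ) : 𝕜) ≠ 0 := by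
    rw [RCLike.ofReal_ne_zero, hxmk]
    exact (Real.rpow_pos_of_pos (norm_pos_iff.2 hxk) _).ne'
  have key : ∀ f : ∀ n, X n →L[𝕜] 𝕜, (∀ n, IsNorming (x n) (f n)) →
      (HasSum (fun n => ((‖x n‖ ^ (p.toReal - 1) : ℝ) : 𝕜) * f n (y n)) 0 ↔
        f m (y m) + t * (‖x m‖ : 𝕜) = 0) := by
    intro f hf
    rw [hasSum_zero_iff_sum_eq_zero (s := {m, k}) (fun n hn => by
      simp only [Finset.mem_insert, Finset.mem_singleton, not_or] at hn
      simp [hy n hn.1 hn.2]), Finset.sum_pair hmk, hyk, map_smul, (hf k).2, ← hxmk, ← mul_add,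
      smul_eq_mul]
    simp only [mul_eq_zero, hpos, false_or]
  rw [lp.birkhoffOrthogonal_iff hp hp_top]
  constructor
  · rintro ⟨f, hf, hsum⟩
    exact ⟨f m, hf m, (key f hf).1 hsum⟩
  · rintro ⟨f, hf, h⟩
    choose g hg using fun n => exists_isNorming 𝕜 (x n)
    have hG : ∀ n, IsNorming (x n) (Function.update g m f n) := by
      intro n
      rcases eq_or_ne n m with rfl | hn
      · simpa using hf
      · simpa [hn] using hg n
    exact ⟨Function.update g m f, hG, (key _ hG).2 (by simpa using h)⟩

theorem lp.birkhoffOrthogonal_left_pair_iff (hp : 1 < p.toReal) (hp_top : p ≠ ⊤) {x y : lp X p}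
    {m k : ι} (hmk : m ≠ k) {t : 𝕜} (hyk : y k = t • x k)
    (hy : ∀ n, n ≠ m → n ≠ k → y n = 0) :
    BirkhoffOrthogonal 𝕜 y x ↔
      ∃ h : X m →L[𝕜] 𝕜, IsNorming (y m) h ∧
        ((‖y m‖ ^ (p.toReal - 1) : ℝ) : 𝕜) * h (x m) +
          ((‖t‖ ^ (p.toReal - 2) : ℝ) : 𝕜) * (starRingEnd 𝕜) t *
            ((‖x k‖ ^ p.toReal : ℝ) : 𝕜) = 0 := by
  classical
  have key : ∀ f : ∀ n, X n →L[𝕜] 𝕜, (∀ n, IsNorming (y n) (f n)) →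
      (HasSum (fun n => ((‖y n‖ ^ (p.toReal - 1) : ℝ) : 𝕜) * f n (x n)) 0 ↔
        ((‖y m‖ ^ (p.toReal - 1) : ℝ) : 𝕜) * f m (x m) +
          ((‖t‖ ^ (p.toReal - 2) : ℝ) : 𝕜) * (starRingEnd 𝕜) t *
            ((‖x k‖ ^ p.toReal : ℝ) : 𝕜) = 0) := by
    intro f hf
    have hfk := hf k
    rw [hyk] at hfk
    rw [hasSum_zero_iff_sum_eq_zero (s := {m, k}) (fun n hn => by
      simp only [Finset.mem_insert, Finset.mem_singleton, not_or] at hn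
      simp [hy n hn.1 hn.2, Real.zero_rpow (show p.toReal - 1 ≠ 0 by linarith)]),
      Finset.sum_pair hmk, hyk, hfk.rpow_mul_apply_of_smul hp]
  rw [lp.birkhoffOrthogonal_iff hp hp_top]
  constructor
  · rintro ⟨f, hf, hsum⟩
    exact ⟨f m, hf m, (key f hf).1 hsum⟩
  · rintro ⟨f, hf, h⟩
    choose g hg using fun n => exists_isNorming 𝕜 (y n)
    have hG : ∀ n, IsNorming (y n) (Function.update g m f n) := by
      intro n
      rcases eq_or_ne n m with rfl | hn
      · simpa using hf
      · simpa [hn] using hg n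
    exact ⟨Function.update g m f, hG, (key _ hG).2 (by simpa using h)⟩

/-- Eliminating the coefficient `t = -z / a` from the two orthogonality relations. -/
theorem rpow_mul_conj_of_add_mul_eq_zero {r a : ℝ} (ha : 0 < a) {z t : 𝕜}
    (h : z + t * (a : 𝕜) = 0) :
    ((‖t‖ ^ (r - 2) : ℝ) : 𝕜) * (starRingEnd 𝕜) t * ((a ^ r : ℝ) : 𝕜) =
      -(((‖z‖ ^ (r - 2) : ℝ) : 𝕜) * (starRingEnd 𝕜) z * (a : 𝕜)) := by
  obtain rfl : z = -(t * (a : 𝕜)) := eq_neg_of_add_eq_zero_left h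
  have h1 : a ^ r = a ^ (r - 2) * a * a := by
    rw [← Real.rpow_add_one ha.ne', ← Real.rpow_add_one ha.ne']; congr 1; ring
  rw [norm_neg, norm_mul, RCLike.norm_ofReal, abs_of_pos ha, Real.mul_rpow (norm_nonneg _) ha.le,
    h1, map_neg, map_mul, RCLike.conj_ofReal]
  push_cast; ring

/-- The coordinate `k` is a counterweight: `t = -f v / ‖x m‖` makes `x ⊥_B y` hold through the given
`f`, and symmetry returns `h`. -/
theorem IsLeftSymmetric.exists_sipRelated (hp : 1 < p.toReal) (hp_top : p ≠ ⊤) {x : lp X p}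
    (hx : IsLeftSymmetric 𝕜 x) {m k : ι} (hmk : m ≠ k) (hxk : x k ≠ 0) (hxmk : ‖x m‖ = ‖x k‖)
    (v : X m) (f : X m →L[𝕜] 𝕜) (hf : IsNorming (x m) f) :
    ∃ h : X m →L[𝕜] 𝕜, IsNorming v h ∧ SipRelated p.toReal (x m) v f h := by
  have ha : 0 < ‖x m‖ := hxmk ▸ norm_pos_iff.2 hxk
  have ha' : (‖x m‖ : 𝕜) ≠ 0 := by simpa using ha.ne'
  have ht : f v + (-(f v) / (‖x m‖ : 𝕜)) * (‖x m‖ : 𝕜) = 0 := by field_simp; simp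
  set t : 𝕜 := -(f v) / (‖x m‖ : 𝕜)
  obtain ⟨y, rfl, hyk, hy⟩ := lp.exists_eq_on_pair p hmk v (t • x k)
  have h1 := hx y ((lp.birkhoffOrthogonal_right_pair_iff hp hp_top hmk hxk hxmk hyk hy).2
    ⟨f, hf, ht⟩)
  obtain ⟨h, hh, hrel⟩ := (lp.birkhoffOrthogonal_left_pair_iff hp hp_top hmk hyk hy).1 h1
  rw [← hxmk, rpow_mul_conj_of_add_mul_eq_zero ha ht] at hrel
  exact ⟨h, hh, by unfold SipRelated; linear_combination hrel⟩

theorem exists_rpow_mul_conj_eq {r : ℝ} (hr : 1 < r) (z : 𝕜) :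
    ∃ t : 𝕜, ((‖t‖ ^ (r - 2) : ℝ) : 𝕜) * (starRingEnd 𝕜) t = z := by
  rcases eq_or_ne z 0 with rfl | hz
  · exact ⟨0, by simp⟩
  have hz0 : 0 < ‖z‖ := norm_pos_iff.2 hz
  have hz' : (‖z‖ : 𝕜) ≠ 0 := by simpa using hz
  set α := ‖z‖ ^ (r - 1)⁻¹ with hα
  have hα0 : 0 < α := Real.rpow_pos_of_pos hz0 _
  have h := Real.rpow_sub_two_mul_self_rpow_inv hr hz0
  -- The modulus inverts the twist; the phase is conjugated because the twist conjugates.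
  refine ⟨(α : 𝕜) * ((starRingEnd 𝕜) z / (‖z‖ : 𝕜)), ?_⟩
  have hn : ‖(α : 𝕜) * ((starRingEnd 𝕜) z / (‖z‖ : 𝕜))‖ = α := by
    rw [norm_mul, norm_div, RCLike.norm_conj, RCLike.norm_ofReal, RCLike.norm_ofReal, abs_norm,
      div_self hz0.ne', mul_one, abs_of_pos hα0]
  rw [hn, map_mul, map_div₀, RCLike.conj_ofReal, RCLike.conj_ofReal, RCLike.conj_conj, ← mul_assoc,
    ← RCLike.ofReal_mul, h]
  field_simp

/-- Here `h` is given, so `t` solves the twisted relation for `y ⊥_B x`, and symmetry returns `f`.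
-/
theorem IsRightSymmetric.exists_sipRelated (hp : 1 < p.toReal) (hp_top : p ≠ ⊤) {x : lp X p}
    (hx : IsRightSymmetric 𝕜 x) {m k : ι} (hmk : m ≠ k) (hxk : x k ≠ 0) (hxmk : ‖x m‖ = ‖x k‖)
    (v : X m) (h : X m →L[𝕜] 𝕜) (hh : IsNorming v h) :
    ∃ f : X m →L[𝕜] 𝕜, IsNorming (x m) f ∧ SipRelated p.toReal (x m) v f h := by
  have ha : 0 < ‖x m‖ := hxmk ▸ norm_pos_iff.2 hxk
  have hb : ((‖x k‖ ^ p.toReal : ℝ) : 𝕜) ≠ 0 := by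
    rw [RCLike.ofReal_ne_zero]
    exact (Real.rpow_pos_of_pos (norm_pos_iff.2 hxk) _).ne'
  obtain ⟨t, ht⟩ := exists_rpow_mul_conj_eq hp
    (-(((‖v‖ ^ (p.toReal - 1) : ℝ) : 𝕜) * h (x m)) / ((‖x k‖ ^ p.toReal : ℝ) : 𝕜))
  obtain ⟨y, rfl, hyk, hy⟩ := lp.exists_eq_on_pair p hmk v (t • x k)
  have hrel : ((‖y m‖ ^ (p.toReal - 1) : ℝ) : 𝕜) * h (x m) +
      ((‖t‖ ^ (p.toReal - 2) : ℝ) : 𝕜) * (starRingEnd 𝕜) t *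
        ((‖x k‖ ^ p.toReal : ℝ) : 𝕜) = 0 := by
    rw [ht, div_mul_cancel₀ _ hb]; ring
  have h1 := hx y ((lp.birkhoffOrthogonal_left_pair_iff hp hp_top hmk hyk hy).2 ⟨h, hh, hrel⟩)
  obtain ⟨f, hf, hft⟩ :=
    (lp.birkhoffOrthogonal_right_pair_iff hp hp_top hmk hxk hxmk hyk hy).1 h1
  rw [← hxmk, rpow_mul_conj_of_add_mul_eq_zero ha hft] at hrel
  exact ⟨f, hf, by unfold SipRelated; linear_combination hrel⟩

theorem lp.birkhoffOrthogonal_single_iff [DecidableEq ι] (n : ι) (a b : X n) :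
    BirkhoffOrthogonal 𝕜 (lp.single p n a) (lp.single p n b) ↔ BirkhoffOrthogonal 𝕜 a b := by
  have hp : 0 < p := zero_lt_one.trans_le Fact.out
  unfold BirkhoffOrthogonal
  simp only [← lp.single_smul, ← lp.single_add, lp.norm_single hp]

theorem IsLeftSymmetric.apply_of_forall_ne {x : lp X p} (hx : IsLeftSymmetric 𝕜 x) {n : ι}
    (hn : ∀ i, i ≠ n → x i = 0) : IsLeftSymmetric 𝕜 (x n) := by
  classical
  intro v hv
  have h := hx (lp.single p n v)
  rw [lp.eq_single_of_forall_ne hn, lp.birkhoffOrthogonal_single_iff,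
    lp.birkhoffOrthogonal_single_iff] at h
  exact h hv

theorem IsRightSymmetric.apply_of_forall_ne {x : lp X p} (hx : IsRightSymmetric 𝕜 x) {n : ι}
    (hn : ∀ i, i ≠ n → x i = 0) : IsRightSymmetric 𝕜 (x n) := by
  classical
  intro v hv
  have h := hx (lp.single p n v)
  rw [lp.eq_single_of_forall_ne hn, lp.birkhoffOrthogonal_single_iff,
    lp.birkhoffOrthogonal_single_iff] at h
  exact h hv

end TwoCoordinates

/-! ### Case split on the support and the main theorem. -/

theorem exists_forall_ne_eq_zero_or_exists_pair {ι : Type*} [Nonempty ι] {X : ι → Type*}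
    [∀ n, Zero (X n)] (x : ∀ n, X n) :
    (∃ n₀, ∀ n, n ≠ n₀ → x n = 0) ∨ ∃ m k, m ≠ k ∧ x m ≠ 0 ∧ x k ≠ 0 := by
  by_cases h : ∃ m, x m ≠ 0
  · obtain ⟨m, hm⟩ := h
    by_cases h' : ∃ k, k ≠ m ∧ x k ≠ 0
    · obtain ⟨k, hkm, hk⟩ := h'
      exact Or.inr ⟨m, k, hkm.symm, hm, hk⟩
    · push Not at h'
      exact Or.inl ⟨m, h'⟩
  · push Not at h
    -- The zero vector counts as supported on one arbitrary coordinate.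
    exact Or.inl ⟨Classical.arbitrary ι, fun n _ => h n⟩

theorem mainTheorem12 {𝕜 : Type*} [RCLike 𝕜] {X : ℕ → Type*}
    [∀ n, NormedAddCommGroup (X n)] [∀ n, NormedSpace 𝕜 (X n)] [∀ n, Nontrivial (X n)]
    (p : ℝ≥0∞) [Fact (1 ≤ p)] (hp_one : 1 < p) (hp_top : p < ⊤) (hp_two : p ≠ 2)
    (x : lp X p) :
    (IsLeftSymmetric 𝕜 x →
      (∃ n₀, (∀ n, n ≠ n₀ → x n = 0) ∧ IsLeftSymmetric 𝕜 (x n₀)) ∨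
      (∃ m k, m ≠ k ∧ (∀ n, n ≠ m → n ≠ k → x n = 0) ∧
        x m ≠ 0 ∧ x k ≠ 0 ∧ ‖x m‖ = ‖x k‖ ∧
        IsSmoothPoint 𝕜 (x m) ∧ IsSmoothPoint 𝕜 (x k) ∧
        IsLeftSipSymmetric 𝕜 p.toReal (x m) ∧ IsLeftSipSymmetric 𝕜 p.toReal (x k))) ∧
    (IsRightSymmetric 𝕜 x →
      (∃ n₀, (∀ n, n ≠ n₀ → x n = 0) ∧ IsRightSymmetric 𝕜 (x n₀)) ∨
      (∃ m k, m ≠ k ∧ (∀ n, n ≠ m → n ≠ k → x n = 0) ∧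
        x m ≠ 0 ∧ x k ≠ 0 ∧ ‖x m‖ = ‖x k‖ ∧
        IsRightSipSymmetric 𝕜 p.toReal (x m) ∧ IsRightSipSymmetric 𝕜 p.toReal (x k))) := by
  have hp : 1 < p.toReal := by
    simpa using (ENNReal.toReal_lt_toReal ENNReal.one_ne_top hp_top.ne).2 hp_one
  have hpt : p ≠ ⊤ := hp_top.ne
  have hp2 : p.toReal ≠ 2 := by
    intro h
    apply hp_two
    rw [← ENNReal.ofReal_toReal hpt, h]
    simp
  constructor
  · intro hx
    rcases exists_forall_ne_eq_zero_or_exists_pair (fun n => x n) with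
      ⟨n₀, hn₀⟩ | ⟨m, k, hmk, hm, hk⟩
    · exact Or.inl ⟨n₀, hn₀, hx.apply_of_forall_ne hn₀⟩
    · have hnorm : ‖x m‖ = ‖x k‖ := hx.norm_apply_eq hp hpt hp2 hm hk
      have Hm := hx.exists_sipRelated hp hpt hmk hk hnorm
      have Hk := hx.exists_sipRelated hp hpt hmk.symm hm hnorm.symm
      exact Or.inr ⟨m, k, hmk, fun n => hx.apply_eq_zero hp hpt hp2 hmk hm hk, hm, hk, hnorm,
        isSmoothPoint_of_forall_sipRelated hp hm Hm, isSmoothPoint_of_forall_sipRelated hp hk Hk,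
        isLeftSipSymmetric_of_forall_sipRelated hm Hm,
        isLeftSipSymmetric_of_forall_sipRelated hk Hk⟩
  · intro hx
    rcases exists_forall_ne_eq_zero_or_exists_pair (fun n => x n) with
      ⟨n₀, hn₀⟩ | ⟨m, k, hmk, hm, hk⟩
    · exact Or.inl ⟨n₀, hn₀, hx.apply_of_forall_ne hn₀⟩
    · have hnorm : ‖x m‖ = ‖x k‖ := hx.norm_apply_eq hp hpt hp2 hm hk
      exact Or.inr ⟨m, k, hmk, fun n => hx.apply_eq_zero hp hpt hp2 hmk hm hk, hm, hk, hnorm,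
        isRightSipSymmetric_of_forall_sipRelated hm
          (hx.exists_sipRelated hp hpt hmk hk hnorm),
        isRightSipSymmetric_of_forall_sipRelated hk
          (hx.exists_sipRelated hp hpt hmk.symm hm hnorm.symm)⟩
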